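/- Fix a signature consisting of function and relation symbols of finite arities. A *structure* is a nonempty set with operations and relations interpreting the symbols, and a *homomorphism* preserves operations and satisfies $h(R^{\mathbf A})\subseteq R^{\mathbf B}$ for each relation symbol $R$. An *atomic formula* has the form $s\approx t$ or $R(\mathbf s)$ with terms $s,t,s_i$. A *quasi-identity* is a sentence $\alpha_1\,\&\cdots\&\,\alpha_k\Rightarrow\beta$ ($k\ge 0$) with all $\alpha_i,\beta$ atomic, and a *quasi-equational theory* is a set of quasi-identities closed under logical consequence (among quasi-identities). A *quasivariety* is a class of structures closed under isomorphic copies, (nonempty) substructures, direct products and ultraproducts. A *congruence* on a structure $\mathbf A$ is a pair $\theta=\langle\theta_0,(\theta_1^R)_R\rangle$, where $\theta_0$ is an equivalence relation on $A$ compatible with the operations and, for each relation symbol $R$ of arity $m$, $R^{\mathbf A}\subseteq\theta_1^R\subseteq A^{m}$ and $\theta_1^R$ is closed under replacing entries by $\theta_0$-equivalent ones. Congruences are ordered by componentwise containment. The quotient $\mathbf A/\theta$ has universe $A/\theta_0$, and its relations are those induced by the $\theta_1^R$. For a quasivariety $\mathscr K$, a congruence $\theta$ is a *$\mathscr K$-congruence*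 if $\mathbf A/\theta\in\mathscr K$. The $\mathscr K$-congruences of $\mathbf A$ form a complete lattice $\operatorname{Con}_{\mathscr K}\mathbf A$. For a set $S$ of atomic facts $a\approx b$, $R(\mathbf a)$ about elements of $A$, let $\operatorname{con}_{\mathscr K}S$ be the least $\mathscr K$-congruence containing $S$, that is, with $(a,b)\in\theta_0$ for each $a\approx b$ in $S$ and $\mathbf a\in\theta_1^R$ for each $R(\mathbf a)$ in $S$. **Theorem.** Let $\mathscr K$ be a quasivariety and let $n\ge 1$ be an integer. Let $\mathbf F=\mathbf F_{\mathscr K}(n)$ be the $\mathscr K$-free structure on $n$ generators, and let $\mathbf T_n$ be the join semilattice, with least element $0$, of compact elements of $\operatorname{Con}_{\mathscr K}\mathbf F$. For each endomorphism $\varepsilon$ of $\mathbf F$ let $\widehat\varepsilon:\mathbf T_n\to\mathbf T_n$ be the $(\vee,0)$-homomorphism that sends $\operatorname{con}_{\mathscr K}S$ to $\operatorname{con}_{\mathscr K}\varepsilon(S)$ for every finite set $S$ of atomic facts about elements of $\mathbf F$. Put $\widehat{\mathscr E}=\{\widehat\varepsilon:\varepsilon\in\operatorname{End}\mathbf F\}$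 and $\mathbf S_n=\langle\mathbf T_n,\vee,0,\widehat{\mathscr E}\rangle$. Then the lattice, ordered by inclusion, of all quasi-equational theories that 1. contain the theory of $\mathscr K$ (the set of all quasi-identities true in every member of $\mathscr K$), and 2. are determined relative to $\mathscr K$ by quasi-identities in at most $n$ variables, i.e. are the set of all consequences of the theory of $\mathscr K$ together with some set of quasi-identities each of which contains at most $n$ variables, is isomorphic to the congruence lattice $\operatorname{Con}\mathbf S_n$, that is, the lattice of equivalence relations on $\mathbf T_n$ compatible with $\vee$ and with every $\widehat\varepsilon\in\widehat{\mathscr E}$, ordered by inclusion. -/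

import Mathlib

universe u

namespace QuasiEq

open FirstOrder CategoryTheory FirstOrder.Language FirstOrder.Language.Structure

/-! ### Structures, atomic formulas and congruences -/

/-- Atomic formulas `a ≈ b` and `R(a₁, …, aₘ)` with entries in `A`. For `A = L.Term X` these are
the usual atomic formulas in the variables `X`; for a structure `A` they are atomic facts about
elements of `A`. -/
inductive Atom (L : FirstOrder.Language.{u, u}) (A : Type u) : Type u
  | eq (a b : A) : Atom L A
  | rel {m : ℕ} (R : L.Relations m) (a : Fin m → A) : Atom L A

namespace Atom

variable {L : FirstOrder.Language.{u, u}} {A B C : Type u}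

/-- Apply a map to all entries. -/
def map (f : A → B) : Atom L A → Atom L B
  | eq a b => eq (f a) (f b)
  | rel R a => rel R (f ∘ a)

/-- An atomic fact is true in the structure `A`. -/
def Holds [L.Structure A] : Atom L A → Prop
  | eq a b => a = b
  | rel R a => RelMap R a

theorem map_map (g : B → C) (f : A → B) (α : Atom L A) : (α.map f).map g = α.map (g ∘ f) := by
  cases α <;> rfl

end Atom

/-- A congruence `⟨θ₀, θ₁⟩` on a structure `A`: a compatible equivalence relation `θ₀`
together with, for each relation symbol `R`, a relation `θ₁^R` that contains `R^A` and is closed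
under replacing entries by `θ₀`-equivalent ones. -/
structure StrCon (L : FirstOrder.Language.{u, u}) (A : Type u) [L.Structure A] where
  eqv : Setoid A
  rels : ∀ {m : ℕ}, L.Relations m → Set (Fin m → A)
  map_fun : ∀ {m : ℕ} (f : L.Functions m) (a b : Fin m → A),
    (∀ i, eqv (a i) (b i)) → eqv (funMap f a) (funMap f b)
  le_rels : ∀ {m : ℕ} (R : L.Relations m) (a : Fin m → A), RelMap R a → a ∈ rels R
  rels_eqv : ∀ {m : ℕ} (R : L.Relations m) (a b : Fin m → A),
    (∀ i, eqv (a i) (b i)) → a ∈ rels R → b ∈ rels R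

namespace StrCon

variable {L : FirstOrder.Language.{u, u}} {A B : Type u} [L.Structure A] [L.Structure B]

/-- The atomic facts that belong to a congruence. -/
def facts (θ : StrCon L A) : Set (Atom L A)
  | .eq a b => θ.eqv a b
  | .rel R a => a ∈ θ.rels R

theorem facts_injective : Function.Injective (facts : StrCon L A → Set (Atom L A)) := by
  intro θ ψ h
  have h1 : θ.eqv = ψ.eqv := by
    ext a b
    exact iff_of_eq (congrFun h (.eq a b))
  have h2 : @rels L A _ θ = @rels L A _ ψ := by
    funext m R
    ext a
    exact iff_of_eq (congrFun h (.rel R a))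
  cases θ
  cases ψ
  simp only at h1 h2
  subst h1
  congr

/-- Congruences are ordered by containment (of both components). -/
instance : PartialOrder (StrCon L A) := PartialOrder.lift facts facts_injective

/-- The structure on `A` whose relations are those of `θ`, ready to be divided by `θ₀`. -/
abbrev prestructure (θ : StrCon L A) : L.Prestructure θ.eqv where
  toStructure := { funMap := funMap, RelMap := fun R a => a ∈ θ.rels R }
  fun_equiv := fun {_} {f} a b h => θ.map_fun f a b h
  rel_equiv := fun {_} {R} a b h =>
    propext ⟨θ.rels_eqv R a b h, θ.rels_eqv R b a fun i => θ.eqv.symm (h i)⟩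

/-- The carrier of the quotient structure `A/θ`. -/
def Quot (θ : StrCon L A) : Type u := Quotient θ.eqv

/-- The quotient structure `A/θ`: operations and relations on the `θ₀`-classes, where `R` holds of
the classes of `a` iff `a ∈ θ₁^R`. -/
instance (θ : StrCon L A) : L.Structure θ.Quot :=
  letI := θ.prestructure
  inferInstanceAs (L.Structure (Quotient θ.eqv))

/-- The canonical homomorphism `A → A/θ`. -/
def proj (θ : StrCon L A) : A →[L] θ.Quot where
  toFun a := Quotient.mk θ.eqv a
  map_fun' f x := (@funMap_quotient_mk' L A θ.eqv θ.prestructure _ f x).symm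
  map_rel' R x h :=
    (@relMap_quotient_mk' L A θ.eqv θ.prestructure _ R x).2 (θ.le_rels R x h)

/-- The kernel of a homomorphism. -/
def ker (h : A →[L] B) : StrCon L A where
  eqv := Setoid.ker h
  rels R := {a | RelMap R (h ∘ a)}
  map_fun f a b hab := by
    have : h ∘ a = h ∘ b := funext hab
    change h (funMap f a) = h (funMap f b)
    rw [h.map_fun, h.map_fun, this]
  le_rels R a ha := h.map_rel R a ha
  rels_eqv R a b hab ha := by
    have : h ∘ a = h ∘ b := funext hab
    change RelMap R (h ∘ b)
    rw [← this]
    exact ha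

theorem mem_ker (h : A →[L] B) (α : Atom L A) : α ∈ (ker h).facts ↔ (α.map h).Holds := by
  cases α <;> rfl

theorem mem_iff_proj (θ : StrCon L A) (α : Atom L A) : α ∈ θ.facts ↔ (α.map θ.proj).Holds := by
  cases α with
  | eq a b => exact (Quotient.eq (r := θ.eqv)).symm
  | rel R a => exact (@relMap_quotient_mk' L A θ.eqv θ.prestructure _ R a).symm

/-- `A / ker h` embeds into `B`. -/
noncomputable def kerEmb (h : A →[L] B) : (ker h).Quot ↪[L] B where
  toFun := Quotient.lift h fun _ _ hab => hab
  inj' := by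
    intro x y
    induction x using Quotient.inductionOn
    induction y using Quotient.inductionOn
    intro hxy
    exact Quotient.sound hxy
  map_fun' f x := by
    obtain ⟨y, rfl⟩ : ∃ y, (ker h).proj ∘ y = x :=
      ⟨fun i => (x i).out, funext fun i => Quotient.out_eq (x i)⟩
    exact (congrArg _ ((ker h).proj.map_fun f y).symm).trans (h.map_fun f y)
  map_rel' R x := by
    obtain ⟨y, rfl⟩ : ∃ y, (ker h).proj ∘ y = x :=
      ⟨fun i => (x i).out, funext fun i => Quotient.out_eq (x i)⟩
    exact (mem_ker h (.rel R y)).symm.trans (mem_iff_proj (ker h) (.rel R y))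

end StrCon

/-! ### Quasivarieties -/

/-- The direct product of structures. -/
instance piStructure {L : FirstOrder.Language.{u, u}} {ι : Type u} (M : ι → Type u)
    [∀ i, L.Structure (M i)] : L.Structure (∀ i, M i) where
  funMap f x i := funMap f fun j => x j i
  RelMap R x := ∀ i, RelMap R fun j => x j i

/-- A quasivariety: a class of (nonempty) structures closed under isomorphism, substructures,
direct products and ultraproducts. -/
structure Quasivariety (L : FirstOrder.Language.{u, u}) where
  carrier : Set (Bundled.{u} L.Structure)
  nonempty : ∀ M ∈ carrier, Nonempty M
  iso : ∀ M ∈ carrier, ∀ N : Bundled.{u} L.Structure, Nonempty (M ≃[L] N) → N ∈ carrier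
  sub : ∀ M ∈ carrier, ∀ S : L.Substructure M, Nonempty S → Bundled.of (c := L.Structure) S ∈ carrier
  prod : ∀ (ι : Type u) (M : ι → Bundled.{u} L.Structure), (∀ i, M i ∈ carrier) →
    Bundled.of (c := L.Structure) (∀ i, M i) ∈ carrier
  ultraprod : ∀ (ι : Type u) (U : Ultrafilter ι) (M : ι → Bundled.{u} L.Structure),
    (∀ i, M i ∈ carrier) → Bundled.of (c := L.Structure) ((U : Filter ι).Product fun i => M i) ∈ carrier

namespace Quasivariety

variable {L : FirstOrder.Language.{u, u}} (K : Quasivariety L)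

/-- Membership of a structure in a quasivariety. -/
def Mem (M : Type u) [L.Structure M] : Prop := Bundled.of (c := L.Structure) M ∈ K.carrier

variable {K}

theorem mem_of_embedding {M N : Type u} [L.Structure M] [L.Structure N] [Nonempty N]
    (hM : K.Mem M) (f : N ↪[L] M) : K.Mem N :=
  K.iso _ (K.sub _ hM f.toHom.range ⟨f.equivRange (Classical.arbitrary N)⟩) _
    ⟨f.equivRange.symm⟩

theorem mem_quot_ker {A M : Type u} [L.Structure A] [L.Structure M] [Nonempty A]
    (hM : K.Mem M) (h : A →[L] M) : K.Mem (StrCon.ker h).Quot :=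
  haveI : Nonempty (StrCon.ker h).Quot := ⟨(StrCon.ker h).proj (Classical.arbitrary A)⟩
  mem_of_embedding hM (StrCon.kerEmb h)

end Quasivariety

/-! ### The lattice of `K`-congruences -/

/-- The set `Con_K A` of `K`-congruences of `A`: those `θ` with `A/θ ∈ K`. -/
def ConK {L : FirstOrder.Language.{u, u}} (K : Quasivariety L) (A : Type u) [L.Structure A] : Type u :=
  {θ : StrCon L A // K.Mem θ.Quot}

namespace ConK

variable {L : FirstOrder.Language.{u, u}} {K : Quasivariety L} {A B : Type u} [L.Structure A] [L.Structure B]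

instance : PartialOrder (ConK K A) := inferInstanceAs (PartialOrder (Subtype _))

/-- The atomic facts that belong to a `K`-congruence. -/
def facts (θ : ConK K A) : Set (Atom L A) := θ.1.facts

theorem le_iff {θ ψ : ConK K A} : θ ≤ ψ ↔ θ.facts ⊆ ψ.facts := Iff.rfl

/-- The kernel of a homomorphism into a member of `K`. -/
def ker [Nonempty A] (hB : K.Mem B) (h : A →[L] B) : ConK K A :=
  ⟨StrCon.ker h, Quasivariety.mem_quot_ker hB h⟩

theorem mem_ker [Nonempty A] (hB : K.Mem B) (h : A →[L] B) (α : Atom L A) :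
    α ∈ (ker hB h).facts ↔ (α.map h).Holds := StrCon.mem_ker h α

/-- The diagonal homomorphism of `A` into a product of quotients. -/
def toProd {ι : Type u} (θ : ι → ConK K A) : A →[L] (∀ i, (θ i).1.Quot) where
  toFun a i := (θ i).1.proj a
  map_fun' f x := funext fun i => (θ i).1.proj.map_fun f x
  map_rel' R x h i := (θ i).1.proj.map_rel R x h

theorem prod_mem {ι : Type u} (θ : ι → ConK K A) : K.Mem (∀ i, (θ i).1.Quot) :=
  K.prod ι (fun i => Bundled.of (c := L.Structure) (θ i).1.Quot) fun i => (θ i).2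

variable [Nonempty A]

/-- The intersection of a set of `K`-congruences. -/
instance : InfSet (ConK K A) :=
  ⟨fun s => ker (prod_mem fun i : s => i.1) (toProd fun i : s => i.1)⟩

theorem mem_sInf (s : Set (ConK K A)) (α : Atom L A) :
    α ∈ (sInf s).facts ↔ ∀ θ ∈ s, α ∈ θ.facts := by
  refine (mem_ker _ _ α).trans ?_
  cases α with
  | eq a b =>
    refine funext_iff.trans ?_
    constructor
    · intro h θ hθ
      exact (StrCon.mem_iff_proj θ.1 (.eq a b)).2 (h ⟨θ, hθ⟩)
    · intro h i
      exact (StrCon.mem_iff_proj i.1.1 (.eq a b)).1 (h i.1 i.2)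
  | rel R a =>
    constructor
    · intro h θ hθ
      exact (StrCon.mem_iff_proj θ.1 (.rel R a)).2 (h ⟨θ, hθ⟩)
    · intro h i
      exact (StrCon.mem_iff_proj i.1.1 (.rel R a)).1 (h i.1 i.2)

/-- `Con_K A` is a complete lattice. -/
instance : CompleteLattice (ConK K A) :=
  completeLatticeOfInf _ fun s =>
    ⟨fun θ hθ α hα => (mem_sInf s α).1 hα θ hθ,
      fun _ hψ α hα => (mem_sInf s α).2 fun _ hθ => hψ hθ hα⟩

/-- The `K`-congruence `con_K S` generated by a set of atomic facts. -/
def con (K : Quasivariety L) (S : Set (Atom L A)) : ConK K A := sInf {ψ | S ⊆ ψ.facts}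

theorem con_le_iff {S : Set (Atom L A)} {θ : ConK K A} : con K S ≤ θ ↔ S ⊆ θ.facts := by
  constructor
  · intro h α hα
    exact h ((mem_sInf _ α).2 fun ψ hψ => hψ hα)
  · intro h
    exact sInf_le h

theorem con_facts (θ : ConK K A) : con K θ.facts = θ :=
  le_antisymm (con_le_iff.2 subset_rfl) (con_le_iff.1 le_rfl)

/-- The union of a directed set of `K`-congruences is a `K`-congruence, hence is their join. -/
theorem mem_sSup_of_directedOn {s : Set (ConK K A)} (hne : s.Nonempty)
    (hs : DirectedOn (· ≤ ·) s) {α : Atom L A} (hα : α ∈ (sSup s).facts) :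
    ∃ θ ∈ s, α ∈ θ.facts := by
  classical
  have : Nonempty s := hne.to_subtype
  have : IsDirectedOrder s := ⟨fun a b => by
    obtain ⟨c, hc, h1, h2⟩ := hs a.1 a.2 b.1 b.2
    exact ⟨⟨c, hc⟩, h1, h2⟩⟩
  let U : Ultrafilter s := Ultrafilter.of Filter.atTop
  have hU : ∀ i : s, {j | i ≤ j} ∈ U := fun i => Ultrafilter.of_le _ (Filter.mem_atTop i)
  let M : s → Type u := fun i => i.1.1.Quot
  have hM : K.Mem ((U : Filter s).Product M) :=
    K.ultraprod s U (fun i => Bundled.of (c := L.Structure) i.1.1.Quot) fun i => i.1.2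
  let ps := Ultraproduct.setoidPrestructure (L := L) M U
  let q : A →[L] ((U : Filter s).Product M) :=
    { toFun := fun a => Quotient.mk _ (fun i => i.1.1.proj a)
      map_fun' := fun f x => by
        refine Eq.trans ?_ (funMap_quotient_mk' ((U : Filter s).productSetoid M) f
          (fun j (i : s) => i.1.1.proj (x j))).symm
        congr 1
        funext i
        exact i.1.1.proj.map_fun f x
      map_rel' := fun R x h => by
        refine (relMap_quotient_mk' ((U : Filter s).productSetoid M) R
          (fun j (i : s) => i.1.1.proj (x j))).2 ?_
        exact Filter.Eventually.of_forall fun i => i.1.1.proj.map_rel R x h }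
  have key : ∀ β : Atom L A, (β.map q).Holds ↔ ∀ᶠ i : s in U, β ∈ i.1.facts := by
    intro β
    have h1 : (∀ᶠ i : s in U, β ∈ i.1.facts) ↔ ∀ᶠ i : s in U, (β.map i.1.1.proj).Holds := by
      simp only [facts, StrCon.mem_iff_proj]
    rw [h1]
    cases β with
    | eq a b => exact Quotient.eq (r := (U : Filter s).productSetoid M)
    | rel R a =>
      exact relMap_quotient_mk' ((U : Filter s).productSetoid M) R
          (fun j (i : s) => i.1.1.proj (a j))
  have hle : sSup s ≤ ker hM q := by
    refine sSup_le fun θ hθ β hβ => (mem_ker _ _ _).2 ((key β).2 ?_)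
    exact Filter.mem_of_superset (hU ⟨θ, hθ⟩) fun j hj => hj hβ
  obtain ⟨i, hi⟩ := ((key α).1 ((mem_ker _ _ _).1 (hle hα))).exists
  exact ⟨i.1, i.2, hi⟩

/-- Finitely generated `K`-congruences are compact. -/
theorem isCompactElement_con {S : Set (Atom L A)} (hS : S.Finite) :
    IsCompactElement (con K S) := by
  rw [CompleteLattice.isCompactElement_iff_le_of_directed_sSup_le]
  intro s hne hs hle
  rw [con_le_iff] at hle
  simp only [con_le_iff]
  induction S, hS using Set.Finite.induction_on with
  | empty => exact hne.imp fun θ hθ => ⟨hθ, Set.empty_subset _⟩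
  | insert _ _ ih =>
    obtain ⟨θ, hθ, h1⟩ := ih fun α hα => hle (Set.mem_insert_of_mem _ hα)
    obtain ⟨ψ, hψ, h2⟩ := mem_sSup_of_directedOn hne hs (hle (Set.mem_insert _ _))
    obtain ⟨χ, hχ, h3, h4⟩ := hs θ hθ ψ hψ
    exact ⟨χ, hχ, Set.insert_subset (h4 h2) (h1.trans h3)⟩

/-- Compact `K`-congruences are finitely generated. -/
theorem exists_eq_con {θ : ConK K A} (hθ : IsCompactElement θ) :
    ∃ S : Set (Atom L A), S.Finite ∧ θ = con K S := by
  rw [CompleteLattice.isCompactElement_iff_le_of_directed_sSup_le] at hθ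
  obtain ⟨_, ⟨S, ⟨hS, hSθ⟩, rfl⟩, h⟩ :=
    hθ (con K '' {S | S.Finite ∧ S ⊆ θ.facts}) ⟨_, ∅, ⟨Set.finite_empty, Set.empty_subset _⟩, rfl⟩
      (by
        rintro _ ⟨S, ⟨hS, hS'⟩, rfl⟩ _ ⟨T, ⟨hT, hT'⟩, rfl⟩
        refine ⟨_, ⟨S ∪ T, ⟨hS.union hT, Set.union_subset hS' hT'⟩, rfl⟩, ?_, ?_⟩
        · exact con_le_iff.2 (Set.subset_union_left.trans (con_le_iff.1 le_rfl))
        · exact con_le_iff.2 (Set.subset_union_right.trans (con_le_iff.1 le_rfl)))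
      (by
        intro α hα
        have : con K {α} ≤ sSup (con K '' {S | S.Finite ∧ S ⊆ θ.facts}) :=
          le_sSup ⟨{α}, ⟨Set.finite_singleton α, Set.singleton_subset_iff.2 hα⟩, rfl⟩
        exact con_le_iff.1 this rfl)
  exact ⟨S, hS, le_antisymm h (con_le_iff.2 hSθ)⟩

/-! ### The action of endomorphisms -/

/-- The action of an endomorphism `ε` on `K`-congruences: the `K`-congruence generated by the
`ε`-images of the atomic facts in `θ`. -/
def hat (ε : A →[L] A) (θ : ConK K A) : ConK K A := con K (Atom.map ε '' θ.facts)

theorem hat_gc (ε : A →[L] A) :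
    GaloisConnection (hat (K := K) ε) fun ψ => ker ψ.2 (ψ.1.proj.comp ε) := by
  intro θ ψ
  rw [hat, con_le_iff, Set.image_subset_iff, le_iff]
  refine forall_congr' fun α => imp_congr_right fun _ => ?_
  rw [mem_ker]
  refine (StrCon.mem_iff_proj ψ.1 _).trans ?_
  rw [Atom.map_map]
  rfl

/-- `ε̂` sends the `K`-congruence generated by a set `S` of atomic facts to the `K`-congruence
generated by `ε S`. In particular `ε̂ (con_K (s, t)) = con_K (ε s, ε t)`, and so on. -/
theorem hat_con (ε : A →[L] A) (S : Set (Atom L A)) :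
    hat ε (con K S) = con K (Atom.map ε '' S) := by
  refine le_antisymm ?_ ?_
  · refine (hat_gc ε).l_le (con_le_iff.2 fun α hα => ?_)
    rw [mem_ker]
    have h : α.map ε ∈ (con K (Atom.map ε '' S)).facts := con_le_iff.1 le_rfl ⟨α, hα, rfl⟩
    have h' := (StrCon.mem_iff_proj _ _).1 h
    rw [Atom.map_map] at h'
    exact h'
  · exact con_le_iff.2 ((Set.image_mono (con_le_iff.1 le_rfl)).trans (con_le_iff.1 le_rfl))

theorem isCompactElement_hat (ε : A →[L] A) {θ : ConK K A} (hθ : IsCompactElement θ) :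
    IsCompactElement (hat ε θ) := by
  obtain ⟨S, hS, rfl⟩ := exists_eq_con hθ
  rw [hat_con]
  exact isCompactElement_con (hS.image _)

end ConK

/-- The compact elements of `Con_K A`. -/
def CompactConK {L : FirstOrder.Language.{u, u}} (K : Quasivariety L) (A : Type u) [L.Structure A]
    [Nonempty A] : Type u :=
  {θ : ConK K A // IsCompactElement θ}

namespace CompactConK

variable {L : FirstOrder.Language.{u, u}} {K : Quasivariety L} {A : Type u} [L.Structure A] [Nonempty A]

/-- The compact `K`-congruences form a join semilattice (joins as in `Con_K A`). -/
instance : SemilatticeSup (CompactConK K A) :=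
  Subtype.semilatticeSup fun {x y} hx hy => by
    obtain ⟨S, hS, rfl⟩ := ConK.exists_eq_con hx
    obtain ⟨T, hT, rfl⟩ := ConK.exists_eq_con hy
    have : ConK.con K S ⊔ ConK.con K T = ConK.con K (S ∪ T) :=
      eq_of_forall_ge_iff fun c => by
        rw [sup_le_iff, ConK.con_le_iff, ConK.con_le_iff, ConK.con_le_iff, Set.union_subset_iff]
    rw [this]
    exact ConK.isCompactElement_con (hS.union hT)

/-- The least compact `K`-congruence is the least `K`-congruence. -/
instance : OrderBot (CompactConK K A) :=
  Subtype.orderBot (p := fun θ : ConK K A => IsCompactElement θ) (by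
    have : (⊥ : ConK K A) = ConK.con K ∅ :=
      (bot_le).antisymm (ConK.con_le_iff.2 (Set.empty_subset _))
    rw [this]
    exact ConK.isCompactElement_con Set.finite_empty)

/-- The operator `ε̂` on compact `K`-congruences; it preserves joins and the least element. -/
def hat (ε : A →[L] A) : SupBotHom (CompactConK K A) (CompactConK K A) where
  toFun θ := ⟨ConK.hat ε θ.1, ConK.isCompactElement_hat ε θ.2⟩
  map_sup' a b := Subtype.ext ((ConK.hat_gc ε).l_sup (a₁ := a.1) (a₂ := b.1))
  map_bot' := Subtype.ext (ConK.hat_gc ε).l_bot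

/-- The set of operators `ε̂`, for all endomorphisms `ε` of `A`. -/
def operators (K : Quasivariety L) (A : Type u) [L.Structure A] [Nonempty A] :
    Set (SupBotHom (CompactConK K A) (CompactConK K A)) :=
  Set.range hat

end CompactConK

/-! ### Congruence lattices of semilattices with operators -/

/-- A congruence of the algebra `⟨S, ∨, 0, ops⟩`: an equivalence relation compatible with joins and
with all operators. -/
structure OpCon {S : Type u} [SemilatticeSup S] [OrderBot S] (ops : Set (SupBotHom S S)) where
  eqv : Setoid S
  sup : ∀ a b c d, eqv a b → eqv c d → eqv (a ⊔ c) (b ⊔ d)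
  op : ∀ f ∈ ops, ∀ a b, eqv a b → eqv (f a) (f b)

namespace OpCon

variable {S : Type u} [SemilatticeSup S] [OrderBot S] {ops : Set (SupBotHom S S)}

theorem eqv_injective : Function.Injective (eqv : OpCon ops → Setoid S) := by
  rintro ⟨⟩ ⟨⟩ h
  simp only at h
  subst h
  rfl

/-- Congruences are ordered by containment. -/
instance : PartialOrder (OpCon ops) := PartialOrder.lift eqv eqv_injective

instance : InfSet (OpCon ops) :=
  ⟨fun s =>
    { eqv := sInf (eqv '' s)
      sup := by
        rintro a b c d h1 h2 _ ⟨θ, hθ, rfl⟩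
        exact θ.sup a b c d (h1 _ ⟨θ, hθ, rfl⟩) (h2 _ ⟨θ, hθ, rfl⟩)
      op := by
        rintro f hf a b h _ ⟨θ, hθ, rfl⟩
        exact θ.op f hf a b (h _ ⟨θ, hθ, rfl⟩) }⟩

/-- The congruence lattice `Con ⟨S, ∨, 0, ops⟩`. -/
instance : CompleteLattice (OpCon ops) :=
  completeLatticeOfInf _ fun s =>
    ⟨fun θ hθ _ _ h => h _ ⟨θ, hθ, rfl⟩, by
      rintro ψ hψ a b h _ ⟨θ, hθ, rfl⟩
      exact hψ hθ h⟩

end OpCon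

/-! ### Free structures -/

/-- The structure of all terms over the variables `X`, with empty relations. -/
def TermStr (L : FirstOrder.Language.{u, u}) (X : Type) : Type u := L.Term X

instance (L : FirstOrder.Language.{u, u}) (X : Type) : L.Structure (TermStr L X) where
  funMap f ts := Term.func f ts
  RelMap _ _ := False

instance (L : FirstOrder.Language.{u, u}) (X : Type) [Nonempty X] : Nonempty (TermStr L X) :=
  ⟨Term.var (Classical.arbitrary X)⟩

/-- The `K`-free structure `F_K(X)` generated by `X`: the quotient of the term structure by its
least `K`-congruence. So `s ≈ t` (or `R(t)`) holds in it iff it is valid in `K`. -/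
def FreeStr {L : FirstOrder.Language.{u, u}} (K : Quasivariety L) (X : Type) [Nonempty X] : Type u :=
  (⊥ : ConK K (TermStr L X)).1.Quot

section

variable {L : FirstOrder.Language.{u, u}} (K : Quasivariety L) (X : Type) [Nonempty X]

instance : L.Structure (FreeStr K X) :=
  inferInstanceAs (L.Structure (⊥ : ConK K (TermStr L X)).1.Quot)

instance : Nonempty (FreeStr K X) :=
  ⟨(⊥ : ConK K (TermStr L X)).1.proj (Classical.arbitrary _)⟩

end

/-! ### Quasi-identities and quasi-equational theories -/

/-- The variables occurring in an atomic formula. -/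
def Atom.vars {L : FirstOrder.Language.{u, u}} : Atom L (L.Term ℕ) → Set ℕ
  | .eq s t => s.varFinset ∪ t.varFinset
  | .rel _ ts => ⋃ i, ((ts i).varFinset : Set ℕ)

/-- A quasi-identity `α₁ & … & αₖ ⟹ β` (`k ≥ 0`) with atomic formulas `αᵢ`, `β` in the variables
`x₀, x₁, …`. -/
structure QuasiIdentity (L : FirstOrder.Language.{u, u}) where
  hyps : List (Atom L (L.Term ℕ))
  concl : Atom L (L.Term ℕ)

namespace QuasiIdentity

variable {L : FirstOrder.Language.{u, u}}

/-- The variables occurring in a quasi-identity. -/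
def vars (q : QuasiIdentity L) : Set ℕ := {x | (∃ α ∈ q.hyps, x ∈ α.vars) ∨ x ∈ q.concl.vars}

/-- The structure `A` satisfies a quasi-identity (under all assignments of the variables). -/
def Sat (A : Type u) [L.Structure A] (q : QuasiIdentity L) : Prop :=
  ∀ v : ℕ → A, (∀ α ∈ q.hyps, (α.map (Term.realize v)).Holds) →
    (q.concl.map (Term.realize v)).Holds

end QuasiIdentity

/-- The quasi-identities that are consequences of `E`: those that hold in every (nonempty)
structure satisfying all members of `E`. -/
def consequences {L : FirstOrder.Language.{u, u}} (E : Set (QuasiIdentity L)) : Set (QuasiIdentity L) :=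
  {q | ∀ (A : Type u) [L.Structure A] [Nonempty A], (∀ p ∈ E, p.Sat A) → q.Sat A}

/-- A quasi-equational theory: a set of quasi-identities closed under consequence. -/
def IsTheory {L : FirstOrder.Language.{u, u}} (T : Set (QuasiIdentity L)) : Prop := consequences T ⊆ T

/-- The quasi-equational theory of `K`: the quasi-identities that hold in all members of `K`. -/
def Quasivariety.theory {L : FirstOrder.Language.{u, u}} (K : Quasivariety L) : Set (QuasiIdentity L) :=
  {q | ∀ M ∈ K.carrier, q.Sat M}

/-- The quasi-equational theories that contain the theory of `K` and that are determined relative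
to `K` by quasi-identities in at most `n` variables, i.e. are axiomatized by the theory of `K`
together with a set of such quasi-identities. -/
def QTh {L : FirstOrder.Language.{u, u}} (K : Quasivariety L) (n : ℕ) : Type u :=
  {T : Set (QuasiIdentity L) // IsTheory T ∧ K.theory ⊆ T ∧
    ∃ E : Set (QuasiIdentity L), (∀ q ∈ E, q.vars.encard ≤ n) ∧ T = consequences (K.theory ∪ E)}

namespace QTh

variable {L : FirstOrder.Language.{u, u}} {K : Quasivariety L} {n : ℕ}

theorem subset_consequences (E : Set (QuasiIdentity L)) : E ⊆ consequences E :=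
  fun q hq _ _ _ h => h q hq

theorem consequences_subset {E T : Set (QuasiIdentity L)} (h : E ⊆ consequences T) :
    consequences E ⊆ consequences T :=
  fun _ hq A _ _ hA => hq A fun _ hp => h hp A hA

/-- Theories are ordered by inclusion. -/
instance : PartialOrder (QTh K n) := inferInstanceAs (PartialOrder (Subtype _))

/-- The theory axiomatized by `K.theory` and the union of a set of theories. -/
instance : SupSet (QTh K n) :=
  ⟨fun (s : Set (QTh K n)) => ⟨consequences (K.theory ∪ ⋃ T ∈ s, T.1), consequences_subset subset_rfl,
    Set.subset_union_left.trans (subset_consequences _),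
    {q | q.vars.encard ≤ n ∧ ∃ T ∈ s, q ∈ T.1}, fun _ hq => hq.1, by
      apply Set.Subset.antisymm <;> apply consequences_subset <;> apply Set.union_subset
      · exact Set.subset_union_left.trans (subset_consequences _)
      · refine Set.iUnion₂_subset fun T hT => ?_
        obtain ⟨E, hE, hTE⟩ := T.2.2.2
        rw [hTE]
        refine consequences_subset (Set.union_subset ?_ ?_)
        · exact Set.subset_union_left.trans (subset_consequences _)
        · refine fun q hq => subset_consequences _ (Or.inr ⟨hE q hq, T, hT, ?_⟩)
          rw [hTE]
          exact subset_consequences _ (Or.inr hq)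
      · exact Set.subset_union_left.trans (subset_consequences _)
      · rintro q ⟨-, T, hT, hq⟩
        exact subset_consequences _ (Or.inr (Set.mem_biUnion hT hq))⟩⟩

/-- These theories form a complete lattice under inclusion. -/
instance : CompleteLattice (QTh K n) :=
  completeLatticeOfSup _ fun s =>
    ⟨fun T hT _ hq => subset_consequences _ (Or.inr (Set.mem_biUnion hT hq)), fun T hT =>
      Set.Subset.trans (consequences_subset (Set.Subset.trans
        (Set.union_subset T.2.2.1 (Set.iUnion₂_subset fun _ hR => hT hR))
        (subset_consequences _))) T.2.1⟩

end QTh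

end QuasiEq

namespace QuasiEq

open FirstOrder CategoryTheory FirstOrder.Language FirstOrder.Language.Structure

/-! ### Atomic formulas under assignments and renamings. -/

section Assignments

variable {L : FirstOrder.Language.{u, u}} {A M : Type u} [L.Structure A] [L.Structure M]

/-! A quasi-identity in `n` variables, evaluated at the free generators of F, is a pair of compact
K-congruences: the one generated by the premises, and the one generated by the premises and the
conclusion. A homomorphism h from F to M is an assignment of `n` variables in M, and the
corresponding instance of the quasi-identity holds iff ker h contains both congruences or neither.
So a theory T induces the relation "contained in the same kernels of homomorphisms into models of T"
on compact congruences. It respects joins, and it respects the operators because precomposing h with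
ε is again a homomorphism into the same model.

The tests use arbitrary models of the theory of K, without showing that they lie in K: if ker h
contains a finite set S, it contains the K-congruence generated by S, because each fact in the
latter is the conclusion of a quasi-identity of K with premises S (`con_subset_ker_of_generators`).

The map from theories to congruences preserves and reflects order, since its value at T determines
which `n`-variable quasi-identities lie in T, and these axiomatize T over K (`QTh.toOpCon_le_iff`).

For surjectivity, let ρ be a congruence and take the theory given by the quasi-identities whose pair
lies in ρ. Pairs in ρ are respected by all its models, because each fact of ψ follows from
generators of θ by one of these quasi-identities (`OpCon.subset_ker_of_eqv`). Conversely, let σ be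
the join of all compact ψ with θ ρ (θ ∨ ψ). By compactness σ contains no other compact congruence,
and closure of ρ under the operators makes F/σ a model (`OpCon.sat_classSup`). Testing in F/σ shows
that no further pairs become related. -/

theorem Atom.exists_map_eq {B C : Type u} {f : B → C} (hf : Function.Surjective f)
    (α : Atom L C) : ∃ β : Atom L B, β.map f = α := by
  cases α with
  | eq a b =>
    obtain ⟨a, rfl⟩ := hf a
    obtain ⟨b, rfl⟩ := hf b
    exact ⟨.eq a b, rfl⟩
  | rel R a =>
    choose g hg using hf
    exact ⟨.rel R (g ∘ a), congrArg (Atom.rel R) (funext fun i => hg (a i))⟩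

theorem Atom.map_hom_realize {X : Type} (h : A →[L] M) (x : X → A) (α : Atom L (L.Term X)) :
    (α.map (Term.realize x)).map h = α.map (Term.realize (h ∘ x)) := by
  rw [Atom.map_map]
  congr 1
  funext t
  exact (HomClass.realize_term h).symm

theorem Atom.map_relabel_realize {X Y : Type} (f : X → Y) (v : Y → A) (α : Atom L (L.Term X)) :
    (α.map (Term.relabel f)).map (Term.realize v) = α.map (Term.realize (v ∘ f)) := by
  rw [Atom.map_map]
  congr 1
  funext t
  exact Term.realize_relabel

theorem realize_congr {v w : ℕ → A} (t : L.Term ℕ) (h : ∀ i ∈ t.varFinset, v i = w i) :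
    t.realize v = t.realize w := by
  induction t with
  | var i => exact h i (by simp [Term.varFinset])
  | func f ts ih =>
    refine congrArg (funMap f) (funext fun j => ih j fun i hi => h i ?_)
    simp only [Term.varFinset, Finset.mem_biUnion]
    exact ⟨j, Finset.mem_univ j, hi⟩

theorem Atom.map_realize_congr {v w : ℕ → A} (α : Atom L (L.Term ℕ))
    (h : ∀ i ∈ α.vars, v i = w i) : α.map (Term.realize v) = α.map (Term.realize w) := by
  cases α with
  | eq s t =>
    exact congrArg₂ Atom.eq (realize_congr s fun i hi => h i (Or.inl hi))
      (realize_congr t fun i hi => h i (Or.inr hi))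
  | rel R ts =>
    exact congrArg (Atom.rel R) (funext fun j =>
      realize_congr (ts j) fun i hi => h i (Set.mem_iUnion.2 ⟨j, hi⟩))

theorem varFinset_relabel_subset {X : Type} [DecidableEq X] (f : X → ℕ) (t : L.Term X) :
    ((t.relabel f).varFinset : Set ℕ) ⊆ Set.range f := by
  induction t with
  | var i => simp [Term.relabel, Term.varFinset]
  | func g ts ih =>
    simp only [Term.relabel, Term.varFinset, Finset.coe_biUnion]
    exact Set.iUnion₂_subset fun i _ => ih i

theorem Atom.vars_relabel_subset {X : Type} [DecidableEq X] (f : X → ℕ)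
    (α : Atom L (L.Term X)) : (α.map (Term.relabel f)).vars ⊆ Set.range f := by
  cases α with
  | eq s t =>
    exact Set.union_subset (varFinset_relabel_subset f s) (varFinset_relabel_subset f t)
  | rel R ts => exact Set.iUnion_subset fun j => varFinset_relabel_subset f (ts j)

end Assignments

/-! ### Evaluating quasi-identities and renaming them into `n` variables. -/

namespace QuasiIdentity

variable {L : FirstOrder.Language.{u, u}} {A M : Type u} [L.Structure A] [L.Structure M]

/-- The premises of a quasi-identity, evaluated under an assignment. -/
def hypFacts (q : QuasiIdentity L) (v : ℕ → A) : Set (Atom L A) :=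
  Atom.map (Term.realize v) '' {α | α ∈ q.hyps}

/-- The conclusion of a quasi-identity, evaluated under an assignment. -/
def conclFact (q : QuasiIdentity L) (v : ℕ → A) : Atom L A := q.concl.map (Term.realize v)

theorem finite_hypFacts (q : QuasiIdentity L) (v : ℕ → A) : (q.hypFacts v).Finite :=
  q.hyps.finite_toSet.image _

theorem sat_iff (q : QuasiIdentity L) : q.Sat A ↔
    ∀ v : ℕ → A, (∀ α ∈ q.hypFacts v, α.Holds) → (q.conclFact v).Holds := by
  simp only [hypFacts, Set.forall_mem_image]
  rfl

theorem image_hypFacts (q : QuasiIdentity L) (h : A →[L] M) (v : ℕ → A) :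
    Atom.map h '' q.hypFacts v = q.hypFacts (h ∘ v) := by
  rw [hypFacts, hypFacts, Set.image_image]
  exact Set.image_congr fun α _ => Atom.map_hom_realize h v α

theorem map_conclFact (q : QuasiIdentity L) (h : A →[L] M) (v : ℕ → A) :
    (q.conclFact v).map h = q.conclFact (h ∘ v) := Atom.map_hom_realize h v _

theorem hypFacts_subset_ker (q : QuasiIdentity L) (h : A →[L] M) (v : ℕ → A) :
    q.hypFacts v ⊆ (StrCon.ker h).facts ↔ ∀ α ∈ q.hypFacts (h ∘ v), α.Holds := by
  rw [← image_hypFacts, Set.forall_mem_image]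
  exact forall₂_congr fun α _ => StrCon.mem_ker h α

theorem conclFact_mem_ker (q : QuasiIdentity L) (h : A →[L] M) (v : ℕ → A) :
    q.conclFact v ∈ (StrCon.ker h).facts ↔ (q.conclFact (h ∘ v)).Holds := by
  rw [← map_conclFact, StrCon.mem_ker]

theorem hypFacts_congr (q : QuasiIdentity L) {v w : ℕ → A} (h : Set.EqOn v w q.vars) :
    q.hypFacts v = q.hypFacts w :=
  Set.image_congr fun α hα => α.map_realize_congr fun _ hi => h (Or.inl ⟨α, hα, hi⟩)

theorem conclFact_congr (q : QuasiIdentity L) {v w : ℕ → A} (h : Set.EqOn v w q.vars) :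
    q.conclFact v = q.conclFact w :=
  q.concl.map_realize_congr fun _ hi => h (Or.inr hi)

/-- If the variables of `q` can be renamed into `n` variables, then assignments to these `n`
variables suffice to test `q`. -/
theorem sat_of_rename {n : ℕ} (q : QuasiIdentity L) {f : ℕ → Fin n} {g : Fin n → ℕ}
    (hfg : ∀ i ∈ q.vars, g (f i) = i)
    (h : ∀ w : Fin n → A, (∀ α ∈ q.hypFacts (w ∘ f), α.Holds) → (q.conclFact (w ∘ f)).Holds) :
    q.Sat A := by
  refine q.sat_iff.2 fun v hv => ?_
  have hvw : Set.EqOn v ((v ∘ g) ∘ f) q.vars := fun i hi => congrArg v (hfg i hi).symm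
  rw [q.conclFact_congr hvw]
  rw [q.hypFacts_congr hvw] at hv
  exact h _ hv

theorem exists_rename {n : ℕ} [NeZero n] (q : QuasiIdentity L) (hq : q.vars.encard ≤ n) :
    ∃ (f : ℕ → Fin n) (g : Fin n → ℕ), ∀ i ∈ q.vars, g (f i) = i := by
  have hfin : q.vars.Finite := Set.finite_of_encard_le_coe hq
  obtain ⟨f, -, hf⟩ := hfin.exists_injOn_of_encard_le (t := (Set.univ : Set (Fin n)))
    (by simpa using hq)
  exact ⟨f, Function.invFunOn f q.vars, fun i hi => hf.leftInvOn_invFunOn hi⟩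

/-- The quasi-identity with premises `S` and conclusion `β` in the variables `x₀, …, xₙ₋₁`. -/
def ofFin {n : ℕ} (S : List (Atom L (L.Term (Fin n)))) (β : Atom L (L.Term (Fin n))) :
    QuasiIdentity L where
  hyps := S.map (Atom.map (Term.relabel Fin.val))
  concl := β.map (Term.relabel Fin.val)

variable {n : ℕ} (S : List (Atom L (L.Term (Fin n)))) (β : Atom L (L.Term (Fin n)))

theorem vars_ofFin_subset : (ofFin S β).vars ⊆ Set.range (Fin.val : Fin n → ℕ) := by
  rintro i (⟨α, hα, hi⟩ | hi)
  · obtain ⟨γ, -, rfl⟩ := List.mem_map.1 hα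
    exact γ.vars_relabel_subset _ hi
  · exact β.vars_relabel_subset _ hi

theorem encard_vars_ofFin : (ofFin S β).vars.encard ≤ n := by
  refine (Set.encard_le_encard (vars_ofFin_subset S β)).trans ?_
  rw [← Set.image_univ]
  exact (Set.encard_image_le _ _).trans (by simp)

theorem hypFacts_ofFin (v : ℕ → A) : (ofFin S β).hypFacts v =
    Atom.map (Term.realize (v ∘ Fin.val)) '' {α | α ∈ S} := by
  ext γ
  simp [hypFacts, ofFin, Atom.map_relabel_realize]

theorem conclFact_ofFin (v : ℕ → A) :
    (ofFin S β).conclFact v = β.map (Term.realize (v ∘ Fin.val)) :=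
  Atom.map_relabel_realize _ _ _

end QuasiIdentity

/-! ### Finitely generated K-congruences. -/

theorem ConK.con_sup_con {L : FirstOrder.Language.{u, u}} {K : Quasivariety L} {A : Type u}
    [L.Structure A] [Nonempty A] (S T : Set (Atom L A)) :
    ConK.con K S ⊔ ConK.con K T = ConK.con K (S ∪ T) :=
  eq_of_forall_ge_iff fun c => by
    rw [sup_le_iff, ConK.con_le_iff, ConK.con_le_iff, ConK.con_le_iff, Set.union_subset_iff]

namespace CompactConK

variable {L : FirstOrder.Language.{u, u}} {K : Quasivariety L} {A : Type u} [L.Structure A]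
  [Nonempty A]

/-- The compact `K`-congruence generated by a finite set of atomic facts. -/
def con (K : Quasivariety L) {S : Set (Atom L A)} (hS : S.Finite) : CompactConK K A :=
  ⟨ConK.con K S, ConK.isCompactElement_con hS⟩

theorem exists_eq_con (θ : CompactConK K A) : ∃ (S : Set (Atom L A)) (hS : S.Finite),
    θ = con K hS := by
  obtain ⟨S, hS, h⟩ := ConK.exists_eq_con θ.2
  exact ⟨S, hS, Subtype.ext h⟩

theorem con_sup_con {S T : Set (Atom L A)} (hS : S.Finite) (hT : T.Finite) :
    con K hS ⊔ con K hT = con K (hS.union hT) :=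
  Subtype.ext (ConK.con_sup_con S T)

theorem con_congr {S T : Set (Atom L A)} (hS : S.Finite) (hT : T.Finite) (h : S = T) :
    con K hS = con K hT := by
  subst h
  rfl

theorem hat_con (ε : A →[L] A) {S : Set (Atom L A)} (hS : S.Finite) :
    hat ε (con K hS) = con K (hS.image (Atom.map ε)) :=
  Subtype.ext (ConK.hat_con ε S)

end CompactConK

/-! ### Homomorphisms into models of the theory of `K` -/

section Models

variable {L : FirstOrder.Language.{u, u}} {K : Quasivariety L} {n : ℕ} [NeZero n]
  {A : Type u} [L.Structure A] [Nonempty A]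

/-- With premises S and conclusion any fact of `con K S`, written as terms in the generators, one
obtains a quasi-identity valid in K, hence in M. Used for the term structure (S empty) and for the
free structure. -/
theorem con_subset_ker_of_generators {x : Fin n → A}
    (hgen : Function.Surjective (Term.realize (L := L) x))
    (hext : ∀ (N : Type u) [L.Structure N], K.Mem N → ∀ w : Fin n → N, ∃ h : A →[L] N, h ∘ x = w)
    {M : Type u} [L.Structure M] (hM : ∀ q ∈ K.theory, q.Sat M) (h : A →[L] M)
    {S : Set (Atom L A)} (hS : S.Finite) (hSh : S ⊆ (StrCon.ker h).facts) :
    (ConK.con K S).facts ⊆ (StrCon.ker h).facts := by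
  intro α hα
  choose lift hlift using Atom.exists_map_eq (L := L) hgen
  let S' := hS.toFinset.toList.map lift
  have hS' : Atom.map (Term.realize x) '' {β | β ∈ S'} = S := by
    ext γ
    simp [S', hlift]
  have hq : QuasiIdentity.ofFin S' (lift α) ∈ K.theory := by
    intro N hN
    refine (QuasiIdentity.sat_iff _).2 fun v => ?_
    obtain ⟨k, hk⟩ := hext N hN (v ∘ Fin.val)
    rw [QuasiIdentity.hypFacts_ofFin, QuasiIdentity.conclFact_ofFin, ← hk,
      ← Atom.map_hom_realize, hlift]
    intro hv
    have hle : ConK.con K S ≤ ConK.ker (show K.Mem N from hN) k := ConK.con_le_iff.2 fun β hβ => by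
      rw [← hS'] at hβ
      obtain ⟨γ, hγ, rfl⟩ := hβ
      refine (ConK.mem_ker (show K.Mem N from hN) k _).2 ?_
      rw [Atom.map_hom_realize]
      exact hv _ ⟨γ, hγ, rfl⟩
    exact (ConK.mem_ker (show K.Mem N from hN) k α).1 (hle hα)
  -- Indices `≥ n` wrap around modulo `n`; this is harmless, as only the restriction along `Fin.val`
  -- matters.
  have hsat := (QuasiIdentity.sat_iff _).1 (hM _ hq) fun k => h (x (Fin.ofNat n k))
  have hv : (fun k => h (x (Fin.ofNat n k))) ∘ Fin.val = h ∘ x := by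
    funext i
    simp
  rw [QuasiIdentity.hypFacts_ofFin, QuasiIdentity.conclFact_ofFin, hv,
    ← Atom.map_hom_realize, hlift] at hsat
  refine (StrCon.mem_ker h α).2 (hsat ?_)
  rintro _ ⟨γ, hγ, rfl⟩
  rw [← Atom.map_hom_realize]
  exact (StrCon.mem_ker h _).1 (hSh (hS' ▸ ⟨γ, hγ, rfl⟩))

/-- Evaluation of terms, as a homomorphism. -/
def termHom {X : Type} {M : Type u} [L.Structure M] (w : X → M) : TermStr L X →[L] M where
  toFun := Term.realize w
  map_fun' _ _ := rfl
  map_rel' _ _ h := h.elim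

/-- The variables, as elements of the term structure. -/
def TermStr.var {X : Type} (i : X) : TermStr L X := (Term.var i : L.Term X)

theorem TermStr.realize_var {X : Type} (t : L.Term X) :
    t.realize (TermStr.var : X → TermStr L X) = t := by
  induction t with
  | var i => rfl
  | func f ts ih => exact congrArg (Term.func f) (funext ih)

/-- A homomorphism whose kernel contains `θ` factors through `A/θ`. -/
def StrCon.liftQuot {M : Type u} [L.Structure M] (θ : StrCon L A)
    (h : A →[L] M) (hθ : θ.facts ⊆ (StrCon.ker h).facts) : θ.Quot →[L] M where
  toFun := Quotient.lift h fun a b hab => hθ (show Atom.eq a b ∈ θ.facts from hab)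
  map_fun' f x := by
    obtain ⟨y, rfl⟩ : ∃ y, θ.proj ∘ y = x :=
      ⟨fun i => (x i).out, funext fun i => Quotient.out_eq (x i)⟩
    exact (congrArg _ (θ.proj.map_fun f y).symm).trans (h.map_fun f y)
  map_rel' R x hx := by
    obtain ⟨y, rfl⟩ : ∃ y, θ.proj ∘ y = x :=
      ⟨fun i => (x i).out, funext fun i => Quotient.out_eq (x i)⟩
    exact hθ ((StrCon.mem_iff_proj θ (.rel R y)).2 hx)

/-! ### Universal property of the free structure. -/

namespace FreeStr

/-- The free generators. -/
def gen (K : Quasivariety L) {X : Type} [Nonempty X] (i : X) : FreeStr K X :=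
  (⊥ : ConK K (TermStr L X)).1.proj (TermStr.var i)

theorem realize_gen {X : Type} [Nonempty X] (t : L.Term X) :
    t.realize (gen K) = (⊥ : ConK K (TermStr L X)).1.proj t := by
  have h := HomClass.realize_term (⊥ : ConK K (TermStr L X)).1.proj
    (v := TermStr.var) (t := t)
  rw [TermStr.realize_var] at h
  exact h

theorem surjective_realize_gen {X : Type} [Nonempty X] :
    Function.Surjective (Term.realize (L := L) (gen K : X → FreeStr K X)) := by
  intro a
  obtain ⟨t, ht⟩ := Quotient.exists_rep (s := (⊥ : ConK K (TermStr L X)).1.eqv) a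
  exact ⟨t, (realize_gen t).trans ht⟩

theorem exists_hom_of_le {X : Type} [Nonempty X] {M : Type u} [L.Structure M] (w : X → M)
    (h : (⊥ : ConK K (TermStr L X)).facts ⊆ (StrCon.ker (termHom w)).facts) :
    ∃ k : FreeStr K X →[L] M, k ∘ gen K = w :=
  ⟨StrCon.liftQuot _ (termHom w) h, rfl⟩

theorem exists_hom_of_mem {X : Type} [Nonempty X] {M : Type u} [L.Structure M] (hM : K.Mem M)
    (w : X → M) : ∃ k : FreeStr K X →[L] M, k ∘ gen K = w :=
  exists_hom_of_le w (bot_le (a := ConK.ker hM (termHom w)))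

/-- Atomic formulas in `n` variables valid in K are premise-free quasi-identities of its theory, so
freeness extends from K to all models of that theory. -/
theorem exists_hom {M : Type u} [L.Structure M] (hM : ∀ q ∈ K.theory, q.Sat M)
    (w : Fin n → M) : ∃ k : FreeStr K (Fin n) →[L] M, k ∘ gen K = w := by
  have hbot : (⊥ : ConK K (TermStr L (Fin n))) = ConK.con K ∅ :=
    bot_le.antisymm (ConK.con_le_iff.2 (Set.empty_subset _))
  refine exists_hom_of_le w ?_
  rw [hbot]
  exact con_subset_ker_of_generators (x := TermStr.var)
    (fun t => ⟨t, TermStr.realize_var t⟩) (fun N _ _ w => ⟨termHom w, rfl⟩) hM _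
    Set.finite_empty (Set.empty_subset _)

theorem con_subset_ker_iff {M : Type u} [L.Structure M] (hM : ∀ q ∈ K.theory, q.Sat M)
    (h : FreeStr K (Fin n) →[L] M) {S : Set (Atom L (FreeStr K (Fin n)))}
    (hS : S.Finite) : (ConK.con K S).facts ⊆ (StrCon.ker h).facts ↔ S ⊆ (StrCon.ker h).facts :=
  ⟨(ConK.con_le_iff.1 le_rfl).trans, con_subset_ker_of_generators surjective_realize_gen
    (fun _ _ hN w => exists_hom_of_mem hN w) hM h hS⟩

end FreeStr

end Models

/-! ### Theories and congruences of the semilattice with operators -/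

section Correspondence

variable {L : FirstOrder.Language.{u, u}} {K : Quasivariety L} {n : ℕ} [NeZero n]

theorem mem_ker_comp {A B M : Type u} [L.Structure A] [L.Structure B] [L.Structure M]
    (h : B →[L] M) (ε : A →[L] B) (α : Atom L A) :
    α ∈ (StrCon.ker (h.comp ε)).facts ↔ α.map ε ∈ (StrCon.ker h).facts := by
  rw [StrCon.mem_ker, StrCon.mem_ker, Atom.map_map]
  rfl

/-- The congruence of a theory `T`: two compact `K`-congruences are related if the same
homomorphisms into models of `T` contain them in their kernels. -/
def QTh.toOpCon (T : QTh K n) :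
    OpCon (CompactConK.operators K (FreeStr K (Fin n))) where
  eqv :=
    { r := fun θ ψ => ∀ (M : Type u) [L.Structure M] [Nonempty M], (∀ q ∈ T.1, q.Sat M) →
        ∀ h : FreeStr K (Fin n) →[L] M,
          (θ.1.facts ⊆ (StrCon.ker h).facts ↔ ψ.1.facts ⊆ (StrCon.ker h).facts)
      iseqv :=
        { refl := fun _ _ _ _ _ _ => Iff.rfl
          symm := fun H M _ _ hM h => (H M hM h).symm
          trans := fun H₁ H₂ M _ _ hM h => (H₁ M hM h).trans (H₂ M hM h) } }
  sup a b c d hab hcd M _ _ hM h := by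
    have key (θ ψ : CompactConK K (FreeStr K (Fin n))) :
        (θ ⊔ ψ).1.facts ⊆ (StrCon.ker h).facts ↔
          θ.1.facts ⊆ (StrCon.ker h).facts ∧ ψ.1.facts ⊆ (StrCon.ker h).facts := by
      obtain ⟨S, hS, rfl⟩ := θ.exists_eq_con
      obtain ⟨R, hR, rfl⟩ := ψ.exists_eq_con
      have hK : ∀ q ∈ K.theory, q.Sat M := fun q hq => hM q (T.2.2.1 hq)
      rw [CompactConK.con_sup_con]
      exact (FreeStr.con_subset_ker_iff hK h (hS.union hR)).trans <| Set.union_subset_iff.trans <|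
        (FreeStr.con_subset_ker_iff hK h hS).symm.and (FreeStr.con_subset_ker_iff hK h hR).symm
    rw [key, key, hab M hM h, hcd M hM h]
  op := by
    rintro _ ⟨ε, rfl⟩ a b hab M _ _ hM h
    -- Adjointness turns a test of ε̂θ by `h` into a test of θ by `h.comp ε`, which has the same
    -- target.
    have key (θ : CompactConK K (FreeStr K (Fin n))) :
        (CompactConK.hat ε θ).1.facts ⊆ (StrCon.ker h).facts ↔
          θ.1.facts ⊆ (StrCon.ker (h.comp ε)).facts := by
      obtain ⟨S, hS, rfl⟩ := θ.exists_eq_con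
      have hK : ∀ q ∈ K.theory, q.Sat M := fun q hq => hM q (T.2.2.1 hq)
      rw [CompactConK.hat_con]
      refine (FreeStr.con_subset_ker_iff hK h (hS.image _)).trans <| Iff.trans ?_
        (FreeStr.con_subset_ker_iff hK (h.comp ε) hS).symm
      rw [Set.image_subset_iff]
      exact forall₂_congr fun α _ => (mem_ker_comp h ε α).symm
    rw [key, key, hab M hM]

/-- The pair of compact `K`-congruences generated by the premises, and by the premises together
with the conclusion, of a quasi-identity under an assignment. -/
def QuasiIdentity.Related (ρ : OpCon (CompactConK.operators K (FreeStr K (Fin n))))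
    (q : QuasiIdentity L) (v : ℕ → FreeStr K (Fin n)) : Prop :=
  ρ.eqv (CompactConK.con K (q.finite_hypFacts v))
    (CompactConK.con K ((q.finite_hypFacts v).union (Set.finite_singleton (q.conclFact v))))

/-- The second congruence contains the first, so only one direction of the equivalence has content,
and that is the instance of `q` at `h ∘ v`. -/
theorem con_hypFacts_subset_ker_iff {M : Type u} [L.Structure M]
    (hM : ∀ q ∈ K.theory, q.Sat M) (q : QuasiIdentity L) (v : ℕ → FreeStr K (Fin n))
    (h : FreeStr K (Fin n) →[L] M) :
    ((CompactConK.con K (q.finite_hypFacts v)).1.facts ⊆ (StrCon.ker h).facts ↔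
      (CompactConK.con K ((q.finite_hypFacts v).union
        (Set.finite_singleton (q.conclFact v)))).1.facts ⊆ (StrCon.ker h).facts) ↔
    ((∀ α ∈ q.hypFacts (h ∘ v), α.Holds) → (q.conclFact (h ∘ v)).Holds) := by
  have h1 := FreeStr.con_subset_ker_iff hM h (q.finite_hypFacts v)
  have h2 := FreeStr.con_subset_ker_iff hM h
    ((q.finite_hypFacts v).union (Set.finite_singleton (q.conclFact v)))
  rw [Set.union_subset_iff, Set.singleton_subset_iff, q.hypFacts_subset_ker,
    q.conclFact_mem_ker] at h2
  rw [q.hypFacts_subset_ker] at h1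
  refine (iff_congr h1 h2).trans ?_
  tauto

theorem StrCon.ker_proj {A : Type u} [L.Structure A] (θ : StrCon L A) :
    StrCon.ker θ.proj = θ :=
  StrCon.facts_injective (Set.ext fun α =>
    (StrCon.mem_ker θ.proj α).trans (StrCon.mem_iff_proj θ α).symm)

theorem QTh.related_of_mem (T : QTh K n) {q : QuasiIdentity L} (hq : q ∈ T.1)
    (v : ℕ → FreeStr K (Fin n)) : q.Related T.toOpCon v := fun _ _ _ hM h =>
  (con_hypFacts_subset_ker_iff (fun p hp => hM p (T.2.2.1 hp)) q v h).2
    (q.sat_iff.1 (hM q hq) (h ∘ v))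

theorem QTh.mem_of_related (T : QTh K n) {q : QuasiIdentity L} (hn : q.vars.encard ≤ n)
    (hq : ∀ f : ℕ → Fin n, q.Related T.toOpCon (FreeStr.gen K ∘ f)) : q ∈ T.1 := by
  refine T.2.1 fun M _ _ hM => ?_
  have hK : ∀ q ∈ K.theory, q.Sat M := fun q hq => hM q (T.2.2.1 hq)
  obtain ⟨f, g, hfg⟩ := q.exists_rename hn
  refine q.sat_of_rename hfg fun w => ?_
  obtain ⟨h, rfl⟩ := FreeStr.exists_hom hK w
  exact (con_hypFacts_subset_ker_iff hK q _ h).1 (hq f M hM h)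

theorem QTh.toOpCon_le_iff {T T' : QTh K n} : T.toOpCon ≤ T'.toOpCon ↔ T ≤ T' := by
  constructor
  · intro hle
    obtain ⟨E, hE, hTE⟩ := T.2.2.2
    -- Only axioms need checking, and those in `E` have at most `n` variables.
    have hsub : K.theory ∪ E ⊆ T'.1 := by
      refine Set.union_subset T'.2.2.1 fun q hq => T'.mem_of_related (hE q hq) fun f => ?_
      exact hle (T.related_of_mem (hTE ▸ subset_consequences _ (Or.inr hq)) _)
    change T.1 ⊆ T'.1
    rw [hTE]
    exact (consequences_subset (hsub.trans (subset_consequences _))).trans T'.2.1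
  · exact fun hle θ ψ H M _ _ hM h => H M (fun q hq => hM q (hle hq)) h

/-! ### From congruences back to theories. -/

theorem OpCon.eqv_sup_of_le {S : Type u} [SemilatticeSup S] [OrderBot S]
    {ops : Set (SupBotHom S S)} (ρ : OpCon ops) {a b c : S} (hab : ρ.eqv a b) (hcb : c ≤ b) :
    ρ.eqv a (a ⊔ c) := by
  have h := ρ.sup a b c c hab (ρ.eqv.refl c)
  rw [sup_eq_left.2 hcb] at h
  exact ρ.eqv.trans hab (ρ.eqv.symm h)

/-- The theory of a congruence: it is axiomatized, relative to `K`, by the quasi-identities in at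
most `n` variables whose premises generate a `K`-congruence related to the one generated by the
premises and the conclusion. -/
def OpCon.toQTh (ρ : OpCon (CompactConK.operators K (FreeStr K (Fin n)))) : QTh K n :=
  ⟨consequences (K.theory ∪ {q | q.vars.encard ≤ n ∧
      ∀ f : ℕ → Fin n, q.Related ρ (FreeStr.gen K ∘ f)}),
    QTh.consequences_subset subset_rfl,
    Set.subset_union_left.trans (QTh.subset_consequences _), _, fun _ hq => hq.1, rfl⟩

theorem QuasiIdentity.Related.hat {ρ : OpCon (CompactConK.operators K (FreeStr K (Fin n)))}
    {q : QuasiIdentity L} {v : ℕ → FreeStr K (Fin n)} (h : q.Related ρ v)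
    (ε : FreeStr K (Fin n) →[L] FreeStr K (Fin n)) : q.Related ρ (ε ∘ v) := by
  have h' := ρ.op _ ⟨ε, rfl⟩ _ _ h
  rw [CompactConK.hat_con, CompactConK.hat_con] at h'
  have h1 := q.image_hypFacts ε v
  have h2 : Atom.map ε '' (q.hypFacts v ∪ {q.conclFact v}) =
      q.hypFacts (ε ∘ v) ∪ {q.conclFact (ε ∘ v)} := by
    rw [Set.image_union, Set.image_singleton, h1, q.map_conclFact]
  unfold QuasiIdentity.Related
  simpa only [h1, h2] using h'

section ClassCongruence

variable (ρ : OpCon (CompactConK.operators K (FreeStr K (Fin n))))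
  (θ : CompactConK K (FreeStr K (Fin n)))

/-- The join of the `ρ`-class of `θ`. -/
noncomputable def OpCon.classSup : ConK K (FreeStr K (Fin n)) :=
  sSup ((fun ψ : CompactConK K (FreeStr K (Fin n)) => ψ.1) '' {ψ | ρ.eqv θ (θ ⊔ ψ)})

theorem OpCon.le_classSup_iff (ψ : CompactConK K (FreeStr K (Fin n))) :
    ψ.1 ≤ ρ.classSup θ ↔ ρ.eqv θ (θ ⊔ ψ) := by
  constructor
  · intro h
    obtain ⟨_, ⟨χ, hχ, rfl⟩, hle⟩ :=
      (CompleteLattice.isCompactElement_iff_le_of_directed_sSup_le _ _).1 ψ.2 _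
      (Set.Nonempty.image _ ⟨θ, by simp⟩)
      (by
        rintro _ ⟨a, ha, rfl⟩ _ ⟨b, hb, rfl⟩
        refine ⟨_, ⟨a ⊔ b, ?_, rfl⟩, le_sup_left (a := a) (b := b), le_sup_right (a := a) (b := b)⟩
        have h := ρ.sup _ _ _ _ ha hb
        rw [sup_idem, sup_sup_sup_comm, sup_idem] at h
        exact h) h
    exact ρ.eqv_sup_of_le hχ (le_sup_of_le_right (show ψ ≤ χ from hle))
  · exact fun h => le_sSup ⟨ψ, h, rfl⟩

theorem OpCon.sat_classSup : ∀ q ∈ ρ.toQTh.1, q.Sat (ρ.classSup θ).1.Quot := by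
  have hne : Nonempty (ρ.classSup θ).1.Quot := K.nonempty _ (ρ.classSup θ).2
  have hF : K.Mem (FreeStr K (Fin n)) := (⊥ : ConK K (TermStr L (Fin n))).2
  refine fun q hq => hq _ fun p hp => ?_
  obtain hp | ⟨hn, hp⟩ := hp
  · exact hp _ (ρ.classSup θ).2
  obtain ⟨f, g, hfg⟩ := p.exists_rename hn
  refine p.sat_of_rename hfg fun w hw => ?_
  obtain ⟨y, rfl⟩ : ∃ y, (ρ.classSup θ).1.proj ∘ y = w :=
    ⟨fun i => (w i).out, funext fun i => Quotient.out_eq _⟩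
  -- An assignment in the quotient lifts to F, and a lift of `n` values is an endomorphism applied
  -- to the generators; this is where the operators enter.
  obtain ⟨ε, rfl⟩ := FreeStr.exists_hom_of_mem hF y
  have h1 := (p.hypFacts_subset_ker (ρ.classSup θ).1.proj (ε ∘ FreeStr.gen K ∘ f)).2 hw
  rw [StrCon.ker_proj] at h1
  have h2 := (ρ.le_classSup_iff θ (CompactConK.con K (p.finite_hypFacts _))).1
    (ConK.con_le_iff.2 h1)
  -- Joining the transported pair with `θ` lets the conclusion be absorbed after the premises.
  have h3 := ρ.eqv.trans h2 (ρ.sup _ _ _ _ (ρ.eqv.refl θ) ((hp f).hat ε))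
  have h4 := ConK.con_le_iff.1 ((ρ.le_classSup_iff θ _).2 h3)
  refine (p.conclFact_mem_ker (ρ.classSup θ).1.proj (ε ∘ FreeStr.gen K ∘ f)).1 ?_
  rw [StrCon.ker_proj]
  exact h4 (Or.inr rfl)

end ClassCongruence

theorem OpCon.eqv_sup_of_toOpCon_toQTh
    (ρ : OpCon (CompactConK.operators K (FreeStr K (Fin n))))
    {θ ψ : CompactConK K (FreeStr K (Fin n))} (h : ρ.toQTh.toOpCon.eqv θ ψ) :
    ρ.eqv θ (θ ⊔ ψ) := by
  have hne : Nonempty (ρ.classSup θ).1.Quot := K.nonempty _ (ρ.classSup θ).2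
  have h1 := h _ (ρ.sat_classSup θ) (ρ.classSup θ).1.proj
  rw [StrCon.ker_proj] at h1
  have hθ : θ.1 ≤ ρ.classSup θ := (ρ.le_classSup_iff θ θ).2 (by simp)
  exact (ρ.le_classSup_iff θ ψ).1 (h1.1 hθ)

theorem OpCon.subset_ker_of_eqv (ρ : OpCon (CompactConK.operators K (FreeStr K (Fin n))))
    {θ ψ : CompactConK K (FreeStr K (Fin n))} (hρ : ρ.eqv θ ψ) {M : Type u} [L.Structure M]
    (hM : ∀ q ∈ ρ.toQTh.1, q.Sat M) (h : FreeStr K (Fin n) →[L] M)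
    (hθ : θ.1.facts ⊆ (StrCon.ker h).facts) : ψ.1.facts ⊆ (StrCon.ker h).facts := by
  obtain ⟨S, hS, rfl⟩ := θ.exists_eq_con
  have hK : ∀ q ∈ K.theory, q.Sat M := fun q hq => hM q (ρ.toQTh.2.2.1 hq)
  intro α hα
  choose lift hlift using
    Atom.exists_map_eq (L := L) (FreeStr.surjective_realize_gen (K := K) (X := Fin n))
  let q := QuasiIdentity.ofFin (hS.toFinset.toList.map lift) (lift α)
  have hvars : q.vars.encard ≤ n := QuasiIdentity.encard_vars_ofFin _ _
  let v : ℕ → FreeStr K (Fin n) := fun k => FreeStr.gen K (Fin.ofNat n k)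
  have hv : v ∘ Fin.val = FreeStr.gen K := by
    funext i
    simp [v]
  have hhyp : q.hypFacts v = S := by
    ext γ
    simp [q, QuasiIdentity.hypFacts_ofFin, hv, hlift]
  have hconcl : q.conclFact v = α := by
    simp only [q, QuasiIdentity.conclFact_ofFin, hv, hlift]
  have hrel : q.Related ρ v := by
    have hle : CompactConK.con K (Set.finite_singleton (q.conclFact v)) ≤ ψ :=
      ConK.con_le_iff.2 (Set.singleton_subset_iff.2 (hconcl ▸ hα))
    have := ρ.eqv_sup_of_le hρ hle
    rw [CompactConK.con_congr hS (q.finite_hypFacts v) hhyp.symm,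
      CompactConK.con_sup_con] at this
    exact this
  have hq : q ∈ ρ.toQTh.1 := by
    refine QTh.subset_consequences _ (Or.inr ⟨hvars, fun f => ?_⟩)
    have hF : K.Mem (FreeStr K (Fin n)) := (⊥ : ConK K (TermStr L (Fin n))).2
    -- Every substitution of generators for variables is induced by an endomorphism, so relatedness
    -- at `v` suffices.
    obtain ⟨ε, hε⟩ := FreeStr.exists_hom_of_mem hF fun i : Fin n => FreeStr.gen K (f i)
    have h1 := hrel.hat ε
    have hεv : Set.EqOn (ε ∘ v) (FreeStr.gen K ∘ f) q.vars := fun i hi => by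
      obtain ⟨j, rfl⟩ := QuasiIdentity.vars_ofFin_subset _ _ hi
      simpa [v] using congrFun hε j
    unfold QuasiIdentity.Related at h1 ⊢
    simpa only [q.hypFacts_congr hεv, q.conclFact_congr hεv] using h1
  have h1 := (q.hypFacts_subset_ker h v).1 (by
    rw [hhyp]
    exact (FreeStr.con_subset_ker_iff hK h hS).1 hθ)
  rw [← hconcl, q.conclFact_mem_ker]
  exact q.sat_iff.1 (hM q hq) _ h1

theorem OpCon.toOpCon_toQTh (ρ : OpCon (CompactConK.operators K (FreeStr K (Fin n)))) :
    ρ.toQTh.toOpCon = ρ := by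
  refine OpCon.eqv_injective (Setoid.ext fun θ ψ => ⟨fun h => ?_, fun h M _ _ hM k => ?_⟩)
  -- Both θ and ψ are ρ-related to their join.
  · have h' := ρ.eqv_sup_of_toOpCon_toQTh (Setoid.symm' _ h)
    rw [sup_comm] at h'
    exact ρ.eqv.trans (ρ.eqv_sup_of_toOpCon_toQTh h) (ρ.eqv.symm h')
  · exact ⟨ρ.subset_ker_of_eqv h hM k, ρ.subset_ker_of_eqv (ρ.eqv.symm h) hM k⟩

end Correspondence

end QuasiEq

theorem theorem3p3 {L : FirstOrder.Language.{u, u}} (K : QuasiEq.Quasivariety L)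
    (n : ℕ) [NeZero n] :
    Nonempty (QuasiEq.QTh K n ≃o
      QuasiEq.OpCon (QuasiEq.CompactConK.operators K (QuasiEq.FreeStr K (Fin n)))) :=
  ⟨RelIso.ofSurjective (OrderEmbedding.ofMapLEIff QuasiEq.QTh.toOpCon
    fun _ _ => QuasiEq.QTh.toOpCon_le_iff) fun ρ => ⟨ρ.toQTh, ρ.toOpCon_toQTh⟩⟩
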